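/- Let $\mathfrak g$ be a finite-dimensional complex simple Lie algebra, not of type $A_1$. Fix a Cartan subalgebra $\mathfrak t$ and a system of simple roots, let $\alpha_0$ be the highest root, and let $(X_{\alpha_0}, X_{-\alpha_0}, H_{\alpha_0})$ with $X_{\pm\alpha_0}\in\mathfrak g_{\pm\alpha_0}$ and $H_{\alpha_0}=[X_{\alpha_0},X_{-\alpha_0}]$ be an $\mathfrak{sl}_2$-triple. Let $\mathfrak h$ be the centralizer of this triple in $\mathfrak g$; it is reductive with Cartan subalgebra $\mathfrak t\cap\mathfrak h$, one has $\mathfrak t=\mathbb C H_{\alpha_0}\oplus(\mathfrak t\cap\mathfrak h)$, and the roots of $\mathfrak h$, extended by $0$ to $H_{\alpha_0}$, are roots of $\mathfrak g$; give $\mathfrak h$ the induced positive roots. Let $\tilde\alpha$ be the highest root of $\mathfrak h$ or, if $\mathfrak h$ has several simple factors, the highest root of any one of them (if $\mathfrak h$ is abelian, which happens only for $\mathfrak g=\mathfrak{sl}_3$, put $\tilde\alpha=0$, the highest weight of the adjoint representation of $\mathfrak h$). Then the symmetric square $S^2\mathfrak g$ has an irreducible component, i.e. an irreducible $\mathfrak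 g$-submodule, $Y_2(\beta)$ whose highest weight is $\alpha_0+\tilde\alpha$. -/

import Mathlib

open scoped TensorProduct

/-! ### The symmetric square -/

section SymmetricSquare

variable (R L : Type*) [CommRing R] [LieRing L] [LieAlgebra R L]

/-- The symmetric square `S²L` of the adjoint representation: the `L`-module of symmetric tensors,
i.e. of the tensors in `L ⊗ L` that are fixed by the flip `x ⊗ y ↦ y ⊗ x`. -/
def symSquare : LieSubmodule R L (L ⊗[R] L) where
  __ := LinearMap.eqLocus (TensorProduct.comm R L L).toLinearMap LinearMap.id
  lie_mem := by
    intro x m hm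
    have key : ∀ t : L ⊗[R] L,
        TensorProduct.comm R L L ⁅x, t⁆ = ⁅x, TensorProduct.comm R L L t⁆ := by
      intro t
      induction t with
      | zero => simp
      | add a b ha hb => simp [ha, hb]
      | tmul a b =>
        simp only [TensorProduct.LieModule.lie_tmul_right, map_add, TensorProduct.comm_tmul]
        exact add_comm _ _
    have hm' : TensorProduct.comm R L L m = m := hm
    change TensorProduct.comm R L L ⁅x, m⁆ = ⁅x, m⁆
    rw [key, hm']

/-- The centralizer in `L` of a set `s`. -/
def lieCentralizer (s : Set L) : LieSubalgebra R L where
  carrier := {x | ∀ y ∈ s, ⁅x, y⁆ = 0}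
  zero_mem' := by simp
  add_mem' := by
    intro a b ha hb y hy
    simp [ha y hy, hb y hy]
  smul_mem' := by
    intro c a ha y hy
    simp [ha y hy]
  lie_mem' := by
    intro a b ha hb y hy
    simp [lie_lie, ha y hy, hb y hy]

end SymmetricSquare

/-! ### Roots and highest weights

`L` is a finite-dimensional complex Lie algebra with nondegenerate Killing form, `H` is a Cartan
subalgebra, and `b` is a base (a system of simple roots) of the root system of `L` relative
to `H`. -/

section Roots

open LieAlgebra LieAlgebra.IsKilling

variable {L : Type*} [LieRing L] [LieAlgebra ℂ L] [FiniteDimensional ℂ L] [IsKilling ℂ L]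
  {H : LieSubalgebra ℂ L} [H.IsCartanSubalgebra]

/-- The root system has type `A₁` when its Cartan matrix is that of `A₁`. -/
def IsTypeA1 (b : (rootSystem H).Base) : Prop :=
  ∃ e : b.support ≃ Fin 1, b.cartanMatrix = (CartanMatrix.A 1).submatrix e e

/-- The sums of simple roots (zero included). A root is positive when it lies here. -/
def posCone (b : (rootSystem H).Base) : AddSubmonoid (Module.Dual ℂ H) :=
  AddSubmonoid.closure ((rootSystem H).root '' b.support)

/-- `α` is the highest root: every root is obtained from it by subtracting simple roots. -/
def IsHighestRoot (b : (rootSystem H).Base) (α : H.root) : Prop :=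
  ∀ β : H.root, (rootSystem H).root α - (rootSystem H).root β ∈ posCone b

/-- `μ` is the highest weight of the `L`-module `M`: there is a nonzero vector of weight `μ` which
is annihilated by all positive root vectors. (To be used for irreducible `M`.) -/
def HasHighestWeight (b : (rootSystem H).Base) (M : Type*) [AddCommGroup M] [Module ℂ M]
    [LieRingModule L M] (μ : Module.Dual ℂ H) : Prop :=
  ∃ v : M, v ≠ 0 ∧ (∀ t : H, ⁅(t : L), v⁆ = μ t • v) ∧
    ∀ β : H.root, (rootSystem H).root β ∈ posCone b → ∀ x ∈ rootSpace H β.1, ⁅x, v⁆ = 0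

/-- `β` is a root of the subalgebra `h` relative to `H`: it is nonzero and it is a weight of `H`
on `h`.
This is used for `h` the centralizer of the `sl₂`-triple of the highest root `α₀`. Then `H` is
the direct sum of the line of the coroot `t₀` of `α₀` and of `H ⊓ h`, which is a Cartan subalgebra
of `h`; as `t₀` commutes with `h`, the roots defined here are the roots of `h` relative to
`H ⊓ h`, extended by zero at `t₀`: this is how they are considered as weights of `L`. -/
def IsRootOf (h : LieSubalgebra ℂ L) (β : Module.Dual ℂ H) : Prop :=
  β ≠ 0 ∧ ∃ x ∈ h, x ≠ 0 ∧ ∀ t : H, ⁅(t : L), x⁆ = β t • x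

/-- `α` is a highest root of `h`: it is maximal among the roots of `h`, where `α ≤ β` means that
`β - α` is a sum of positive roots of `h`. If `h` is simple there is exactly one; in general, when
`h` is reductive, these are the highest roots of the simple factors of `h`. If `h` has no roots
at all then, by convention, its highest root (the highest weight of its adjoint representation)
is `0`. -/
def IsHighestRootOf (b : (rootSystem H).Base) (h : LieSubalgebra ℂ L)
    (α : Module.Dual ℂ H) : Prop :=
  (IsRootOf h α ∧ ∀ β, IsRootOf h β →
    β - α ∈ AddSubmonoid.closure {γ | IsRootOf h γ ∧ γ ∈ posCone b} → β = α) ∨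
  ((∀ β : Module.Dual ℂ H, ¬ IsRootOf h β) ∧ α = 0)

end Roots

/-! The Killing form κ identifies L ⊗ L with End L as L-modules, symmetric tensors corresponding to
self-adjoint operators. It is enough to find a nonzero self-adjoint operator of weight α₀ + α'
killed by the positive root vectors, and to know that a highest weight vector generates an
irreducible submodule.

Let x be a highest root vector of the centralizer 𝔥 of the triple (a nonzero element of H ∩ 𝔥 if 𝔥
has no roots) and k = 1/κ(e, f). The operator is Q(e, x) = ad e ∘ ad x + k(κ(x, ·) e + κ(e, ·) x),
that is `quadraticOperator k e x`. It is self-adjoint because [e, x] = 0, nonzero because it sends f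
to x, and Q is equivariant in both arguments. A positive root vector y kills e, so it moves Q(e, x)
to Q(e, [y, x]). If y commutes with t₀, then y lies in 𝔥 and [y, x] = 0. Otherwise [y, x] commutes
with e and lies in [L, e]; there Q(e, ·) vanishes, by differentiating the extremality identity Q(e,
e) = 0 (`quadraticOperator_eq_zero`).

Irreducibility comes from the Casimir operator, without complete reducibility: it is scalar on the
generated module, and its eigenvalue (μ + 2ρ, μ) rules out a highest weight strictly below μ. -/

section Decomposition

open LieAlgebra LieAlgebra.IsKilling LieModule
open scoped ComplexOrder

/-! ### Positive cone, positivity of root lengths, and 2ρ. -/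

section RootCombinatorics

variable {L : Type*} [LieRing L] [LieAlgebra ℂ L] [FiniteDimensional ℂ L] [IsKilling ℂ L]
  {H : LieSubalgebra ℂ L} [H.IsCartanSubalgebra] (b : (rootSystem H).Base)

/-- The linear functional on the weights which takes the value `1` on every simple root. -/
noncomputable def heightFunctional : Module.Dual ℂ H →ₗ[ℂ] ℂ :=
  b.toWeightBasis.constr ℂ fun _ ↦ (1 : ℂ)

lemma heightFunctional_simple {i : H.root} (hi : i ∈ b.support) :
    heightFunctional b ((rootSystem H).root i) = 1 := by
  have := b.toWeightBasis.constr_basis ℂ (fun _ ↦ (1 : ℂ)) ⟨i, hi⟩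
  simpa [heightFunctional] using this

lemma heightFunctional_root (β : H.root) :
    heightFunctional b ((rootSystem H).root β) = b.height β := by
  obtain ⟨f, -, -, hf⟩ := b.exists_root_eq_sum_int β
  rw [b.height_eq_sum hf, hf, map_sum, Int.cast_sum]
  refine Finset.sum_congr rfl fun j hj ↦ ?_
  rw [map_zsmul, heightFunctional_simple b hj]
  simp

variable {b}

/-- This makes the cone pointed. In the order on ℂ, positive means real and positive. -/
lemma eq_zero_or_heightFunctional_pos {ν : Module.Dual ℂ H} (hν : ν ∈ posCone b) :
    ν = 0 ∨ 0 < heightFunctional b ν := by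
  induction hν using AddSubmonoid.closure_induction with
  | mem x hx =>
    obtain ⟨i, hi, rfl⟩ := hx
    right
    rw [heightFunctional_simple b hi]
    exact one_pos
  | zero => exact .inl rfl
  | add x y _ _ hx hy =>
    rcases hx with rfl | hx
    · simpa using hy
    rcases hy with rfl | hy
    · simpa using Or.inr hx
    · right
      rw [map_add]
      exact add_pos hx hy

lemma eq_zero_of_mem_posCone_of_neg_mem {ν : Module.Dual ℂ H} (hν : ν ∈ posCone b)
    (hν' : -ν ∈ posCone b) : ν = 0 := by
  rcases eq_zero_or_heightFunctional_pos hν with h | h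
  · exact h
  rcases eq_zero_or_heightFunctional_pos hν' with h' | h'
  · exact neg_eq_zero.mp h'
  · rw [map_neg] at h'
    exact absurd (add_pos h h') (by simp)

lemma root_mem_posCone_iff {β : H.root} :
    (rootSystem H).root β ∈ posCone b ↔ b.IsPos β := by
  have key {β : H.root} (h : (rootSystem H).root β ∈ posCone b) : b.IsPos β := by
    rcases eq_zero_or_heightFunctional_pos h with h | h
    · exact absurd h ((rootSystem H).ne_zero β)
    · rw [heightFunctional_root] at h
      exact_mod_cast h
  refine ⟨key, fun h ↦ (b.root_mem_or_neg_mem β).resolve_right fun h' ↦ ?_⟩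
  let := (rootSystem H).indexNeg
  have : b.IsPos (-β) := key <| by
    change (rootSystem H).root ((rootSystem H).reflectionPerm β β) ∈ posCone b
    rwa [RootPairing.root_reflectionPerm, RootPairing.reflection_apply_self]
  exact (RootPairing.Base.IsPos.neg_iff_not b β).mp this h

lemma exists_neg_root (β : H.root) : ∃ γ : H.root, (γ.1 : H → ℂ) = -β.1 := by
  refine ⟨⟨-β.1, ?_⟩, by simp⟩
  simpa using LieSubalgebra.isNonZero_coe_root β

/-- With r = (α, α), the coroot has Killing norm 4/r. This norm is also a sum of squares of integers
β(α^∨), in which β = α contributes 4. -/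
lemma root_apply_cartanEquivDual_symm_pos (α : H.root) :
    0 < α.1 ((cartanEquivDual H).symm α.1.toLinear) := by
  have hα : α.1.IsNonZero := LieSubalgebra.isNonZero_coe_root α
  have h0 := root_apply_cartanEquivDual_symm_ne_zero hα
  set r := α.1 ((cartanEquivDual H).symm α.1.toLinear) with hr
  have h1 : traceForm ℂ H L (coroot α.1) (coroot α.1) = 4 * r⁻¹ := by
    rw [traceForm_coroot, root_apply_coroot hα]
    simp only [nsmul_eq_mul, smul_eq_mul]
    push_cast
    ring
  have h2 : 0 < traceForm ℂ H L (coroot α.1) (coroot α.1) := by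
    rw [← LieAlgebra.restrict_killingForm, restrict_killingForm_eq_sum]
    simp only [LinearMap.sum_apply, LinearMap.smulRight_apply, LinearMap.smul_apply, smul_eq_mul]
    refine Finset.sum_pos' (fun β _ ↦ ?_) ⟨α.1, α.2, ?_⟩
    · simp only [Weight.toLinear_apply]
      rw [apply_coroot_eq_cast]
      exact_mod_cast mul_self_nonneg _
    · simp only [Weight.toLinear_apply]
      rw [root_apply_coroot hα]
      norm_num
  rw [h1] at h2
  have h3 : (0 : ℂ) < r⁻¹ := by
    have : r⁻¹ = (4 : ℂ)⁻¹ * (4 * r⁻¹) := by ring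
    rw [this]
    exact mul_pos (by positivity) h2
  exact inv_pos.mp h3

lemma cartanEquivDual_symm_root_eq (α : H.root) :
    (cartanEquivDual H).symm α.1.toLinear =
      (α.1 ((cartanEquivDual H).symm α.1.toLinear) / 2) • coroot α.1 := by
  have h0 := (root_apply_cartanEquivDual_symm_pos α).ne'
  rw [coroot, ← Nat.cast_smul_eq_nsmul ℂ, smul_smul, smul_smul]
  field_simp
  simp

lemma apply_cartanEquivDual_symm_comm (μ ν : Module.Dual ℂ H) :
    μ ((cartanEquivDual H).symm ν) = ν ((cartanEquivDual H).symm μ) := by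
  have h (μ : Module.Dual ℂ H) (x : H) : μ x = traceForm ℂ H L ((cartanEquivDual H).symm μ) x :=
    (LinearMap.BilinForm.apply_toDual_symm_apply (hB := traceForm_cartan_nondegenerate ℂ L H)
      _ _).symm
  rw [h μ, h ν, LieModule.traceForm_comm]

open Classical in
variable (b) in
/-- The sum of the positive roots. -/
noncomputable def sumPosRoots : Module.Dual ℂ H :=
  ∑ β : H.root with b.IsPos β, (rootSystem H).root β

/-- The simple reflection permutes the positive roots other than i and changes the sign of the
pairing with the coroot, so only i itself contributes. -/
lemma sumPosRoots_apply_coroot {i : H.root} (hi : i ∈ b.support) :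
    sumPosRoots b (coroot i.1) = 2 := by
  classical
  have h2 : (rootSystem H).root i (coroot i.1) = 2 :=
    root_apply_coroot (LieSubalgebra.isNonZero_coe_root i)
  have hmem : i ∈ Finset.univ.filter (fun β : H.root ↦ b.IsPos β) := by
    simpa using RootPairing.Base.isPos_of_mem_support hi
  rw [sumPosRoots, ← Finset.add_sum_erase _ _ hmem, LinearMap.add_apply, h2]
  suffices h : (∑ β ∈ (Finset.univ.filter (fun β : H.root ↦ b.IsPos β)).erase i,
      (rootSystem H).root β) (coroot i.1) = 0 by rw [h, add_zero]
  rw [LinearMap.sum_apply]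
  have hneg (β : H.root) : (rootSystem H).root ((rootSystem H).reflectionPerm i β) (coroot i.1) =
      -(rootSystem H).root β (coroot i.1) := by
    rw [RootPairing.root_reflectionPerm, RootPairing.reflection_apply, LinearMap.sub_apply,
      LinearMap.smul_apply, h2]
    simp
    ring
  refine Finset.sum_involution (fun β _ ↦ (rootSystem H).reflectionPerm i β) ?_ ?_ ?_ ?_
  · intro β _
    rw [hneg]
    ring
  · intro β _ hβ h
    apply hβ
    have := hneg β
    rw [h] at this
    exact self_eq_neg.mp this
  · intro β hβ
    simp only [Finset.mem_erase, Finset.mem_filter, Finset.mem_univ, true_and] at hβ ⊢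
    refine ⟨fun h ↦ ?_, RootPairing.Base.IsPos.reflectionPerm hβ.2 hi hβ.1⟩
    have h3 := RootPairing.Base.IsPos.reflectionPerm hβ.2 hi hβ.1
    have h4 := congrArg ((rootSystem H).reflectionPerm i) h
    rw [(rootSystem H).reflectionPerm_self] at h4
    let := (rootSystem H).indexNeg
    have h5 : β = -i := h4
    have h6 := hβ.2
    rw [h5] at h6
    exact (RootPairing.Base.IsPos.neg_iff_not b i).mp h6 (RootPairing.Base.isPos_of_mem_support hi)
  · intro β _
    exact (rootSystem H).reflectionPerm_self i β

/-- A linear form which is nonnegative on the simple coroots is, once shifted by the sum of the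
positive roots, positive on the nonzero sums of simple roots. -/
lemma pos_of_mem_posCone {μ : Module.Dual ℂ H} (hμ : ∀ i ∈ b.support, 0 ≤ μ (coroot i.1))
    {ν : Module.Dual ℂ H} (hν : ν ∈ posCone b) (hν0 : ν ≠ 0) :
    0 < (μ + sumPosRoots b) ((cartanEquivDual H).symm ν) := by
  suffices h : ν = 0 ∨ 0 < (μ + sumPosRoots b) ((cartanEquivDual H).symm ν) from
    h.resolve_left hν0
  clear hν0
  induction hν using AddSubmonoid.closure_induction with
  | mem x hx =>
    obtain ⟨i, hi, rfl⟩ := hx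
    right
    change 0 < (μ + sumPosRoots b) ((cartanEquivDual H).symm i.1.toLinear)
    rw [cartanEquivDual_symm_root_eq, map_smul, LinearMap.add_apply,
      sumPosRoots_apply_coroot hi, smul_eq_mul]
    exact mul_pos (div_pos (root_apply_cartanEquivDual_symm_pos i) two_pos)
      (add_pos_of_nonneg_of_pos (hμ i hi) two_pos)
  | zero => exact .inl rfl
  | add x y _ _ hx hy =>
    rcases hx with rfl | hx
    · simpa using hy
    rcases hy with rfl | hy
    · simpa using Or.inr hx
    · right
      rw [map_add, map_add]
      exact add_pos hx hy

end RootCombinatorics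

/-! ### Tensors as endomorphisms. -/

section KillingTensor

variable (L : Type*) [LieRing L] [LieAlgebra ℂ L] [FiniteDimensional ℂ L] [IsKilling ℂ L]

/-- The identification of `L ⊗ L` with the endomorphisms of `L` by means of the Killing form. -/
noncomputable def killingTensorEquiv : L ⊗[ℂ] L ≃ₗ[ℂ] (L →ₗ[ℂ] L) :=
  TensorProduct.comm ℂ L L ≪≫ₗ
    TensorProduct.congr ((killingForm ℂ L).toDual (killingForm_nondegenerate ℂ L))
      (LinearEquiv.refl ℂ L) ≪≫ₗ dualTensorHomEquiv ℂ L L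

variable {L}

@[simp]
lemma killingTensorEquiv_tmul (x y z : L) :
    killingTensorEquiv L (x ⊗ₜ y) z = killingForm ℂ L y z • x := by
  simp [killingTensorEquiv, LinearMap.BilinForm.toDual_def]

lemma killingTensorEquiv_lie (y : L) (t : L ⊗[ℂ] L) :
    killingTensorEquiv L ⁅y, t⁆ =
      ad ℂ L y ∘ₗ killingTensorEquiv L t - killingTensorEquiv L t ∘ₗ ad ℂ L y := by
  ext z
  induction t with
  | zero => simp
  | add a b ha hb =>
    simp only [lie_add, map_add, LinearMap.add_apply, ha, hb, LinearMap.sub_apply,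
      LinearMap.comp_apply]
    abel
  | tmul a b =>
    have h : killingForm ℂ L ⁅y, b⁆ z = -killingForm ℂ L b ⁅y, z⁆ := by
      rw [← lie_skew, map_neg, LinearMap.neg_apply]
      congr 1
      exact LieModule.traceForm_apply_lie_apply ℂ L L b y z
    simp [TensorProduct.LieModule.lie_tmul_right, h, sub_eq_add_neg]

lemma killingForm_killingTensorEquiv_comm (t : L ⊗[ℂ] L) (x y : L) :
    killingForm ℂ L (killingTensorEquiv L t x) y =
      killingForm ℂ L x (killingTensorEquiv L (TensorProduct.comm ℂ L L t) y) := by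
  induction t with
  | zero => simp
  | add a b ha hb => simp [ha, hb]
  | tmul a b =>
    simp only [killingTensorEquiv_tmul, TensorProduct.comm_tmul, map_smul, LinearMap.smul_apply,
      smul_eq_mul]
    rw [LieModule.traceForm_comm ℂ L L x b, mul_comm]

/-- Under the Killing form, self-adjoint endomorphisms correspond to symmetric tensors. -/
lemma killingTensorEquiv_symm_mem_symSquare {T : L →ₗ[ℂ] L}
    (hT : ∀ x y, killingForm ℂ L (T x) y = killingForm ℂ L x (T y)) :
    (killingTensorEquiv L).symm T ∈ symSquare ℂ L := by
  change TensorProduct.comm ℂ L L _ = (killingTensorEquiv L).symm T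
  rw [LinearEquiv.eq_symm_apply]
  ext y
  refine sub_eq_zero.mp ((killingForm_nondegenerate ℂ L).2 _ fun x ↦ ?_)
  rw [map_sub, ← killingForm_killingTensorEquiv_comm, LinearEquiv.apply_symm_apply, hT, sub_self]

end KillingTensor

/-! ### The Casimir operator and its eigenvalue on highest weight vectors. -/

section Casimir

variable {L : Type*} [LieRing L] [LieAlgebra ℂ L]
  (M : Type*) [AddCommGroup M] [Module ℂ M] [LieRingModule L M] [LieModule ℂ L M]

/-- The action of `L ⊗ L` on an `L`-module: `x ⊗ y` acts by `m ↦ ⁅x, ⁅y, m⁆⁆`. -/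
noncomputable def tensorAction : L ⊗[ℂ] L →ₗ[ℂ] Module.End ℂ M :=
  LinearMap.mul' ℂ (Module.End ℂ M) ∘ₗ
    TensorProduct.map (toEnd ℂ L M : L →ₗ[ℂ] Module.End ℂ M) (toEnd ℂ L M : L →ₗ[ℂ] Module.End ℂ M)

variable {M}

@[simp]
lemma tensorAction_tmul (x y : L) (m : M) : tensorAction M (x ⊗ₜ y) m = ⁅x, ⁅y, m⁆⁆ := by
  simp [tensorAction]

lemma lie_tensorAction (y : L) (t : L ⊗[ℂ] L) (m : M) :
    ⁅y, tensorAction M t m⁆ = tensorAction M ⁅y, t⁆ m + tensorAction M t ⁅y, m⁆ := by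
  induction t with
  | zero => simp
  | add a b ha hb =>
    simp only [lie_add, map_add, LinearMap.add_apply, ha, hb]
    abel
  | tmul a b =>
    simp only [TensorProduct.LieModule.lie_tmul_right, map_add, LinearMap.add_apply,
      tensorAction_tmul]
    rw [leibniz_lie y a, leibniz_lie y b, lie_add, add_assoc]

variable [FiniteDimensional ℂ L] [IsKilling ℂ L]

variable (L M) in
/-- The Casimir operator of the Killing form. -/
noncomputable def casimir : Module.End ℂ M :=
  tensorAction M ((killingTensorEquiv L).symm LinearMap.id)

/-- The Casimir tensor is invariant because the identity commutes with every ad y. -/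
lemma lie_casimir (y : L) (m : M) : ⁅y, casimir L M m⁆ = casimir L M ⁅y, m⁆ := by
  have h : ⁅y, (killingTensorEquiv L).symm LinearMap.id⁆ = 0 := by
    apply (killingTensorEquiv L).injective
    rw [killingTensorEquiv_lie, LinearEquiv.apply_symm_apply]
    simp
  rw [casimir, lie_tensorAction, h]
  simp

variable {H : LieSubalgebra ℂ L} [H.IsCartanSubalgebra]

variable (H) in
lemma exists_dual_rootVectors (α : H.root) :
    ∃ e ∈ rootSpace H α.1, ∃ f ∈ rootSpace H (-α.1 : H → ℂ), killingForm ℂ L e f = 1 := by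
  obtain ⟨e, he, he0⟩ := α.1.exists_ne_zero
  obtain ⟨f, hf, hef⟩ : ∃ f ∈ rootSpace H (-α.1 : H → ℂ), killingForm ℂ L e f ≠ 0 := by
    contrapose! he0
    simpa using mem_ker_killingForm_of_mem_rootSpace_of_forall_rootSpace_neg ℂ L H he he0
  refine ⟨e, he, (killingForm ℂ L e f)⁻¹ • f, Submodule.smul_mem _ _ hf, ?_⟩
  simp [hef]

lemma exists_smul_of_mem_rootSpace (α : H.root) {x y : L} (hx : x ∈ rootSpace H α.1)
    (hx0 : x ≠ 0) (hy : y ∈ rootSpace H α.1) : ∃ c : ℂ, y = c • x := by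
  have h := finrank_rootSpace_eq_one α.1 (LieSubalgebra.isNonZero_coe_root α)
  obtain ⟨c, hc⟩ := (finrank_eq_one_iff_of_nonzero' (⟨x, hx⟩ : rootSpace H α.1)
    (by simpa [Subtype.ext_iff] using hx0)).mp h ⟨y, hy⟩
  exact ⟨c, by simpa [Subtype.ext_iff] using hc.symm⟩

/-- An induction principle along the root space decomposition. -/
lemma rootSpace_induction (H : LieSubalgebra ℂ L) [H.IsCartanSubalgebra] {p : L → Prop}
    (h0 : ∀ x ∈ H, p x) (h1 : ∀ α : H.root, ∀ x ∈ rootSpace H α.1, p x)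
    (hadd : ∀ x y, p x → p y → p (x + y)) (x : L) : p x := by
  have hx : x ∈ ⨆ χ : Weight ℂ H L, rootSpace H χ := by
    rw [iSup_genWeightSpace_eq_top' ℂ H L]
    trivial
  induction hx using LieSubmodule.iSup_induction' with
  | zero => exact h0 0 H.zero_mem
  | add x y _ _ hx hy => exact hadd x y hx hy
  | mem χ x hx =>
    by_cases hχ : χ.IsZero
    · refine h0 x ?_
      rw [hχ.eq] at hx
      simpa using hx
    · exact h1 ⟨χ, by simpa using hχ⟩ x hx

/-- The Casimir tensor in terms of the root space decomposition. -/
lemma killingTensorEquiv_symm_id {ι : Type*} [Fintype ι] (B : Module.Basis ι ℂ H)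
    (e f : H.root → L) (he : ∀ α, e α ∈ rootSpace H α.1)
    (hf : ∀ α, f α ∈ rootSpace H (-α.1 : H → ℂ)) (hef : ∀ α, killingForm ℂ L (e α) (f α) = 1) :
    (killingTensorEquiv L).symm LinearMap.id =
      ∑ i, (B i : L) ⊗ₜ[ℂ] ((cartanEquivDual H).symm (B.coord i) : L) + ∑ α, e α ⊗ₜ f α := by
  classical
  rw [LinearEquiv.symm_apply_eq]
  ext x
  simp only [LinearMap.id_apply, map_add, map_sum, LinearMap.add_apply, LinearMap.sum_apply,
    killingTensorEquiv_tmul]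
  have hH {h : L} (hh : h ∈ H) : h ∈ rootSpace H (0 : H → ℂ) :=
    toLieSubmodule_le_rootSpace_zero ℂ L H hh
  have hne (α : H.root) : (α.1 : H → ℂ) ≠ 0 := by
    simp [LieSubalgebra.isNonZero_coe_root α]
  induction x using rootSpace_induction H with
  | h0 x hx =>
    have h1 (i : ι) : killingForm ℂ L ((cartanEquivDual H).symm (B.coord i)) x =
        B.repr ⟨x, hx⟩ i :=
      LinearMap.BilinForm.apply_toDual_symm_apply (hB := traceForm_cartan_nondegenerate ℂ L H)
        (B.coord i) ⟨x, hx⟩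
    have h2 (α : H.root) : killingForm ℂ L (f α) x = 0 :=
      killingForm_apply_eq_zero_of_mem_rootSpace_of_add_ne_zero ℂ L H (hf α) (hH hx)
        (by simp [hne α])
    simp only [h1, h2, zero_smul, Finset.sum_const_zero, add_zero]
    exact (congrArg (Subtype.val : H → L) (B.sum_repr ⟨x, hx⟩)).symm.trans
      (map_sum H.toSubmodule.subtype _ _)
  | h1 β x hx =>
    have h1 (i : ι) : killingForm ℂ L ((cartanEquivDual H).symm (B.coord i)) x = 0 :=
      killingForm_apply_eq_zero_of_mem_rootSpace_of_add_ne_zero ℂ L H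
        (hH ((cartanEquivDual H).symm (B.coord i)).2) hx (by simp [hne β])
    have h2 (α : H.root) (hα : α ≠ β) : killingForm ℂ L (f α) x = 0 :=
      killingForm_apply_eq_zero_of_mem_rootSpace_of_add_ne_zero ℂ L H (hf α) hx fun h ↦
        hα (Subtype.ext (DFunLike.coe_injective (neg_add_eq_zero.mp h)))
    have h0 : e β ≠ 0 := fun h ↦ zero_ne_one (by rw [← hef β, h, map_zero, LinearMap.zero_apply])
    obtain ⟨c, rfl⟩ := exists_smul_of_mem_rootSpace β (he β) h0 hx
    rw [Finset.sum_eq_single β (fun α _ hα ↦ by rw [h2 α hα, zero_smul]) (by simp)]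
    simp [h1, LieModule.traceForm_comm ℂ L L (f β), hef β]
  | hadd x y hx hy =>
    nth_rewrite 1 [hx, hy]
    simp only [map_add, add_smul, Finset.sum_add_distrib]
    abel

/-- The Cartan part gives (μ, μ). For α positive, e f v = [e, f] v contributes (μ, α); for α
negative, f is a positive root vector and kills v. -/
lemma casimir_apply_of_highestWeight {b : (rootSystem H).Base} {v : M} {μ : Module.Dual ℂ H}
    (hv : ∀ t : H, ⁅(t : L), v⁆ = μ t • v)
    (hv' : ∀ β : H.root, (rootSystem H).root β ∈ posCone b → ∀ x ∈ rootSpace H β.1, ⁅x, v⁆ = 0) :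
    casimir L M v = (μ + sumPosRoots b) ((cartanEquivDual H).symm μ) • v := by
  classical
  let B := Module.finBasis ℂ H
  choose e he f hf hef using exists_dual_rootVectors H
  rw [casimir, killingTensorEquiv_symm_id B e f he hf hef]
  simp only [map_add, map_sum, LinearMap.add_apply, LinearMap.sum_apply, tensorAction_tmul,
    add_smul]
  congr 1
  · simp only [hv, lie_smul, smul_smul, ← Finset.sum_smul]
    congr 1
    have h := congrArg (fun ν ↦ μ ((cartanEquivDual H).symm ν)) (B.sum_dual_apply_smul_coord μ)
    simp only [map_sum, map_smul, smul_eq_mul] at h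
    rw [← h]
    exact Finset.sum_congr rfl fun i _ ↦ mul_comm _ _
  · rw [sumPosRoots, LinearMap.sum_apply, Finset.sum_filter, Finset.sum_smul]
    refine Finset.sum_congr rfl fun α _ ↦ ?_
    split_ifs with hα
    · have h1 : ⁅e α, f α⁆ = ((cartanEquivDual H).symm α.1.toLinear : L) := by
        rw [lie_eq_killingForm_smul_of_mem_rootSpace_of_mem_rootSpace_neg (he α) (hf α), hef,
          one_smul]
      rw [leibniz_lie, hv' α (root_mem_posCone_iff.mpr hα) _ (he α), lie_zero, add_zero, h1, hv,
        apply_cartanEquivDual_symm_comm]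
      rfl
    · obtain ⟨γ, hγ⟩ := exists_neg_root α
      have hγ' : (rootSystem H).root γ ∈ posCone b := by
        have h1 := (b.root_mem_or_neg_mem α).resolve_left fun h ↦ hα (root_mem_posCone_iff.mp h)
        have h2 : (rootSystem H).root γ = -(rootSystem H).root α :=
          LinearMap.ext fun t ↦ congrFun hγ t
        rwa [h2]
      have h2 : f α ∈ rootSpace H γ.1 := by
        rw [hγ]
        exact hf α
      rw [hv' γ hγ' _ h2, lie_zero, zero_smul]

end Casimir

/-! ### Highest weight vectors generate irreducible modules. -/

section HighestWeight

variable {L : Type*} [LieRing L] [LieAlgebra ℂ L] [FiniteDimensional ℂ L] [IsKilling ℂ L]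
  {H : LieSubalgebra ℂ L} [H.IsCartanSubalgebra] {b : (rootSystem H).Base}
  {M : Type*} [AddCommGroup M] [Module ℂ M] [LieRingModule L M] [LieModule ℂ L M]

/-- `v` has weight `μ` and is annihilated by the positive root spaces. -/
structure IsHighestWeightVector (b : (rootSystem H).Base) (μ : Module.Dual ℂ H) (v : M) :
    Prop where
  ne_zero : v ≠ 0
  lie_cartan : ∀ t : H, ⁅(t : L), v⁆ = μ t • v
  lie_pos : ∀ β : H.root, (rootSystem H).root β ∈ posCone b → ∀ x ∈ rootSpace H β.1, ⁅x, v⁆ = 0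

lemma IsHighestWeightVector.nonneg [FiniteDimensional ℂ M] {μ : Module.Dual ℂ H} {v : M}
    (hv : IsHighestWeightVector b μ v) {i : H.root} (hi : i ∈ b.support) :
    0 ≤ μ (coroot i.1) := by
  have hi0 := LieSubalgebra.isNonZero_coe_root i
  obtain ⟨h, e, f, ht, he, hf⟩ := exists_isSl2Triple_of_weight_isNonZero hi0
  have hh := ht.h_eq_coroot hi0 he hf
  have P : ht.HasPrimitiveVectorWith v (μ (coroot i.1)) :=
    ⟨hv.ne_zero, by rw [hh, hv.lie_cartan],
      hv.lie_pos i (AddSubmonoid.subset_closure ⟨i, hi, rfl⟩) e he⟩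
  obtain ⟨n, hn⟩ := P.exists_nat
  rw [hn]
  exact Nat.cast_nonneg n

/-- The Casimir operator separates highest weights which are comparable. -/
lemma IsHighestWeightVector.eq_of_casimir_eq [FiniteDimensional ℂ M] {μ ν : Module.Dual ℂ H}
    {v w : M} (hv : IsHighestWeightVector b μ v) (hw : IsHighestWeightVector b ν w)
    (hμν : μ - ν ∈ posCone b) {c : ℂ} (hcv : casimir L M v = c • v)
    (hcw : casimir L M w = c • w) : ν = μ := by
  by_contra hne
  have h1 : (μ + sumPosRoots b) ((cartanEquivDual H).symm μ) = c :=
    smul_left_injective ℂ hv.ne_zero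
      ((casimir_apply_of_highestWeight hv.lie_cartan hv.lie_pos).symm.trans hcv)
  have h2 : (ν + sumPosRoots b) ((cartanEquivDual H).symm ν) = c :=
    smul_left_injective ℂ hw.ne_zero
      ((casimir_apply_of_highestWeight hw.lie_cartan hw.lie_pos).symm.trans hcw)
  -- The difference of the two eigenvalues is (μ + ν + 2ρ, μ - ν), which would be positive.
  have h3 := pos_of_mem_posCone (b := b) (μ := μ + ν)
    (fun i hi ↦ add_nonneg (hv.nonneg hi) (hw.nonneg hi)) hμν
    (sub_ne_zero.mpr (Ne.symm hne))
  have h4 := apply_cartanEquivDual_symm_comm μ ν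
  simp only [map_sub, LinearMap.add_apply] at h1 h2 h3
  refine h3.ne' ?_
  linear_combination h1 - h2 - h4

lemma lie_mem_weightSpace_add {α : H.root} {x : L} (hx : x ∈ rootSpace H α.1)
    {χ : Module.Dual ℂ H} {m : M} (hm : ∀ t : H, ⁅(t : L), m⁆ = χ t • m) (t : H) :
    ⁅(t : L), ⁅x, m⁆⁆ = (χ + α.1.toLinear) t • ⁅x, m⁆ := by
  have h1 : ⁅(t : L), x⁆ = α.1 t • x := lie_eq_smul_of_mem_rootSpace hx t
  rw [leibniz_lie, h1, hm, smul_lie, lie_smul, ← add_smul, add_comm]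
  rfl

/-- Nonzero finite-dimensional modules have highest weight vectors. -/
lemma exists_isHighestWeightVector [FiniteDimensional ℂ M] (b : (rootSystem H).Base)
    (N : LieSubmodule ℂ L M) (hN : N ≠ ⊥) :
    ∃ μ, ∃ w ∈ N, IsHighestWeightVector b μ w := by
  let S : Set (Module.Dual ℂ H) := {χ | ∃ w ∈ N, w ≠ 0 ∧ ∀ t : H, ⁅(t : L), w⁆ = χ t • w}
  have hS : S.Finite := by
    refine Set.Finite.of_finite_image (f := fun χ : Module.Dual ℂ H ↦ (χ : H → ℂ)) ?_
      DFunLike.coe_injective.injOn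
    refine (finite_genWeightSpace_ne_bot ℂ H M).subset ?_
    rintro _ ⟨χ, ⟨w, -, hw0, hw⟩, rfl⟩ h
    refine hw0 ((LieSubmodule.mem_bot w).mp (h ▸ weightSpace_le_genWeightSpace M χ ?_))
    exact (mem_weightSpace χ w).mpr hw
  have hS0 : S.Nonempty := by
    have : Nontrivial N := (LieSubmodule.nontrivial_iff_ne_bot ℂ L M).mpr hN
    obtain ⟨χ, hχ⟩ := exists_nontrivial_weightSpace_of_isSolvable ℂ H N
    obtain ⟨w, hw⟩ := exists_ne (0 : weightSpace N χ)
    refine ⟨χ, w.1, w.1.2, by simpa using hw, fun t ↦ ?_⟩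
    exact congrArg Subtype.val ((mem_weightSpace χ w.1).mp w.2 t)
  -- A positive root vector strictly raises the height, so a weight of maximal height works.
  obtain ⟨μ, ⟨w, hwN, hw0, hw⟩, hmax⟩ :=
    hS.exists_maximalFor (fun χ ↦ (heightFunctional b χ).re) S hS0
  refine ⟨μ, w, hwN, hw0, hw, fun β hβ x hx ↦ ?_⟩
  by_contra hne
  have h1 := hmax (j := μ + β.1.toLinear)
    ⟨⁅x, w⁆, N.lie_mem hwN, hne, lie_mem_weightSpace_add hx hw⟩
  have h2 : 0 < heightFunctional b β.1.toLinear :=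
    (eq_zero_or_heightFunctional_pos hβ).resolve_left ((rootSystem H).ne_zero β)
  have h3 := (Complex.pos_iff.mp h2).1
  simp only [map_add, Complex.add_re] at h1
  have := h1 (by linarith)
  linarith

/-- If `v` is a highest weight vector, a subspace containing `v` and stable under the negative root
spaces contains the submodule generated by `v`. -/
lemma IsHighestWeightVector.lieSpan_le {μ : Module.Dual ℂ H} {v : M}
    (hv : IsHighestWeightVector b μ v) (D : Submodule ℂ M) (hvD : v ∈ D)
    (hD : ∀ β : H.root, -(rootSystem H).root β ∈ posCone b → ∀ f ∈ rootSpace H β.1,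
      ∀ u ∈ D, ⁅f, u⁆ ∈ D) :
    (LieSubmodule.lieSpan ℂ L {v}).toSubmodule ≤ D := by
  let W : Set (Submodule ℂ M) := {W | v ∈ W ∧ ∀ β : H.root, -(rootSystem H).root β ∈ posCone b →
    ∀ f ∈ rootSpace H β.1, ∀ u ∈ W, ⁅f, u⁆ ∈ W}
  have hW : sInf W ∈ W := by
    refine ⟨Submodule.mem_sInf.mpr fun U hU ↦ hU.1, fun β hβ f hf u hu ↦ ?_⟩
    exact Submodule.mem_sInf.mpr fun U hU ↦ hU.2 β hβ f hf u (Submodule.mem_sInf.mp hu U hU)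
  -- `sInf W` is the smallest subspace containing v and stable under negative root vectors. Once B
  -- belongs to W, minimality makes `sInf W` stable under all of L.
  let B : Submodule ℂ M :=
    { carrier := {u | u ∈ sInf W ∧ (∀ t : H, ⁅(t : L), u⁆ ∈ sInf W) ∧
        ∀ β : H.root, (rootSystem H).root β ∈ posCone b → ∀ x ∈ rootSpace H β.1,
          ⁅x, u⁆ ∈ sInf W}
      zero_mem' := by simp
      add_mem' := by
        rintro x y ⟨hx1, hx2, hx3⟩ ⟨hy1, hy2, hy3⟩
        refine ⟨add_mem hx1 hy1, fun t ↦ ?_, fun β hβ z hz ↦ ?_⟩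
        · rw [lie_add]
          exact add_mem (hx2 t) (hy2 t)
        · rw [lie_add]
          exact add_mem (hx3 β hβ z hz) (hy3 β hβ z hz)
      smul_mem' := by
        rintro c x ⟨hx1, hx2, hx3⟩
        refine ⟨Submodule.smul_mem _ c hx1, fun t ↦ ?_, fun β hβ z hz ↦ ?_⟩
        · rw [lie_smul]
          exact Submodule.smul_mem _ c (hx2 t)
        · rw [lie_smul]
          exact Submodule.smul_mem _ c (hx3 β hβ z hz) }
  have hBL {u : M} (hu : u ∈ B) (x : L) : ⁅x, u⁆ ∈ sInf W := by
    induction x using rootSpace_induction H with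
    | h0 x hx => exact hu.2.1 ⟨x, hx⟩
    | h1 β x hx =>
      rcases b.root_mem_or_neg_mem β with hβ | hβ
      · exact hu.2.2 β hβ x hx
      · exact hW.2 β hβ x hx u hu.1
    | hadd x y hx hy =>
      rw [add_lie]
      exact add_mem hx hy
  have hB : B ∈ W := by
    refine ⟨⟨hW.1, fun t ↦ ?_, fun β hβ x hx ↦ ?_⟩, fun β hβ f hf u hu ↦
      ⟨hBL hu f, fun t ↦ ?_, fun γ hγ x hx ↦ ?_⟩⟩
    · rw [hv.lie_cartan]
      exact Submodule.smul_mem _ _ hW.1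
    · rw [hv.lie_pos β hβ x hx]
      exact zero_mem _
    · rw [leibniz_lie]
      exact add_mem (hBL hu _) (hW.2 β hβ f hf _ (hu.2.1 t))
    · rw [leibniz_lie]
      exact add_mem (hBL hu _) (hW.2 β hβ f hf _ (hu.2.2 γ hγ x hx))
  let U : LieSubmodule ℂ L M :=
    { sInf W with lie_mem := fun {x u} hu ↦ hBL (Submodule.mem_sInf.mp hu B hB) x }
  have h1 : LieSubmodule.lieSpan ℂ L {v} ≤ U :=
    LieSubmodule.lieSpan_le.mpr (Set.singleton_subset_iff.mpr hW.1)
  intro u hu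
  exact Submodule.mem_sInf.mp (h1 hu) D ⟨hvD, hD⟩

lemma eq_zero_of_mem_iSup_weightSpace {χ : Module.Dual ℂ H} {m : M}
    (hm : ∀ t : H, ⁅(t : L), m⁆ = χ t • m) (S : Set (Module.Dual ℂ H)) (hχ : χ ∉ S)
    (h : m ∈ ⨆ ψ ∈ S, (weightSpace M (ψ : H → ℂ)).toSubmodule) : m = 0 := by
  have h1 := iSupIndep_genWeightSpace ℂ H M (χ : H → ℂ)
  rw [← LieSubmodule.disjoint_toSubmodule] at h1
  refine Submodule.disjoint_def.mp h1 m ?_ ?_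
  · exact weightSpace_le_genWeightSpace M χ ((mem_weightSpace χ m).mpr hm)
  · suffices hle : ⨆ ψ ∈ S, (weightSpace M (ψ : H → ℂ)).toSubmodule ≤
        (⨆ ψ, ⨆ (_ : ψ ≠ (χ : H → ℂ)), genWeightSpace M ψ).toSubmodule from hle h
    refine iSup₂_le fun ψ hψ ↦ ?_
    refine (weightSpace_le_genWeightSpace M (ψ : H → ℂ)).trans ?_
    refine le_iSup₂_of_le (ψ : H → ℂ) (fun h ↦ hχ ?_) le_rfl
    rwa [← DFunLike.coe_injective h]

/-- The weights of the module generated by a highest weight vector. -/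
lemma IsHighestWeightVector.weight_of_mem_lieSpan {μ χ : Module.Dual ℂ H} {v w : M}
    (hv : IsHighestWeightVector b μ v) (hw : w ∈ LieSubmodule.lieSpan ℂ L {v}) (hw0 : w ≠ 0)
    (hχ : ∀ t : H, ⁅(t : L), w⁆ = χ t • w) :
    μ - χ ∈ posCone b ∧ (χ = μ → ∃ c : ℂ, w = c • v) := by
  let S : Set (Module.Dual ℂ H) := {χ | μ - χ ∈ posCone b ∧ χ ≠ μ}
  let E : Submodule ℂ M := ⨆ ψ ∈ S, (weightSpace M (ψ : H → ℂ)).toSubmodule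
  have hlow {β : H.root} (hβ : -(rootSystem H).root β ∈ posCone b) {ψ : Module.Dual ℂ H}
      (hψ : μ - ψ ∈ posCone b) : ψ + β.1.toLinear ∈ S := by
    have h1 : μ - (ψ + β.1.toLinear) = (μ - ψ) + -(rootSystem H).root β := by
      rw [rootSystem_root_apply]
      abel
    refine ⟨h1 ▸ add_mem hψ hβ, fun h ↦ (rootSystem H).ne_zero β ?_⟩
    refine neg_eq_zero.mp (eq_zero_of_mem_posCone_of_neg_mem hβ ?_)
    rw [h, sub_self] at h1
    rwa [← eq_neg_of_add_eq_zero_left h1.symm]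
  have hmem {ψ : Module.Dual ℂ H} (hψ : ψ ∈ S) {m : M} (hm : ∀ t : H, ⁅(t : L), m⁆ = ψ t • m) :
      m ∈ E :=
    Submodule.mem_iSup_of_mem ψ (Submodule.mem_iSup_of_mem hψ ((mem_weightSpace ψ m).mpr hm))
  have hlie {β : H.root} (hβ : -(rootSystem H).root β ∈ posCone b) {f : L}
      (hf : f ∈ rootSpace H β.1) {u : M} (hu : u ∈ E) : ⁅f, u⁆ ∈ E := by
    have : E ≤ E.comap (toEnd ℂ L M f) := by
      refine iSup₂_le fun ψ hψ m hm ↦ ?_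
      exact hmem (hlow hβ hψ.1) (lie_mem_weightSpace_add hf ((mem_weightSpace ψ m).mp hm))
    exact this hu
  -- E collects the weight spaces strictly below μ, so in the generated module weight μ occurs only
  -- on the line of v.
  have hle := hv.lieSpan_le ((ℂ ∙ v) ⊔ E)
    (Submodule.mem_sup_left (Submodule.mem_span_singleton_self v)) (by
      intro β hβ f hf u hu
      obtain ⟨a, ha, u', hu', rfl⟩ := Submodule.mem_sup.mp hu
      obtain ⟨c, rfl⟩ := Submodule.mem_span_singleton.mp ha
      rw [lie_add, lie_smul]
      refine Submodule.mem_sup_right (add_mem (Submodule.smul_mem _ c ?_) (hlie hβ hf hu'))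
      exact hmem (hlow hβ (by simp)) (lie_mem_weightSpace_add hf hv.lie_cartan))
  obtain ⟨a, ha, u, hu, hau⟩ := Submodule.mem_sup.mp (hle hw)
  obtain ⟨c, rfl⟩ := Submodule.mem_span_singleton.mp ha
  by_cases hχμ : χ = μ
  · subst hχμ
    refine ⟨by simp, fun _ ↦ ⟨c, ?_⟩⟩
    have h1 : u = w - c • v := by rw [← hau, add_sub_cancel_left]
    have h2 : u = 0 := eq_zero_of_mem_iSup_weightSpace (χ := χ) (fun t ↦ by
      rw [h1, lie_sub, lie_smul, hχ, hv.lie_cartan, smul_sub, smul_comm c]) S (fun h ↦ h.2 rfl) hu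
    rw [← hau, h2, add_zero]
  · refine ⟨?_, fun h ↦ absurd h hχμ⟩
    by_contra hcone
    refine hw0 (eq_zero_of_mem_iSup_weightSpace hχ (insert μ S) ?_ ?_)
    · rintro (h | h)
      · exact hχμ h
      · exact hcone h.1
    · rw [iSup_insert, ← hau]
      refine add_mem (Submodule.mem_sup_left (Submodule.smul_mem _ c ?_))
        (Submodule.mem_sup_right hu)
      exact (mem_weightSpace μ v).mpr hv.lie_cartan

/-- The submodule generated by a highest weight vector is irreducible. -/
lemma IsHighestWeightVector.isIrreducible_lieSpan [FiniteDimensional ℂ M] {μ : Module.Dual ℂ H}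
    {v : M} (hv : IsHighestWeightVector b μ v) :
    LieModule.IsIrreducible ℂ L (LieSubmodule.lieSpan ℂ L {v}) := by
  set V := LieSubmodule.lieSpan ℂ L {v}
  have hvV : v ∈ V := LieSubmodule.subset_lieSpan rfl
  have : Nontrivial V := ⟨⟨v, hvV⟩, 0, fun h ↦ hv.ne_zero (congrArg Subtype.val h)⟩
  have hcv := casimir_apply_of_highestWeight hv.lie_cartan hv.lie_pos
  set c := (μ + sumPosRoots b) ((cartanEquivDual H).symm μ)
  let K : LieSubmodule ℂ L M :=
    { LinearMap.ker (casimir L M - c • LinearMap.id) with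
      lie_mem := by
        intro x m hm
        have hm' : casimir L M m - c • m = 0 := hm
        change casimir L M ⁅x, m⁆ - c • ⁅x, m⁆ = 0
        rw [← lie_casimir, ← lie_smul, ← lie_sub, hm', lie_zero] }
  have hVK : V ≤ K := by
    refine LieSubmodule.lieSpan_le.mpr (Set.singleton_subset_iff.mpr ?_)
    change casimir L M v - c • v = 0
    rw [hcv, sub_self]
  refine LieModule.IsIrreducible.mk fun N hN ↦ ?_
  have hN' : N.map V.incl ≠ ⊥ := fun h ↦ hN <| by
    rw [eq_bot_iff]
    intro x hx
    have h1 : (x : M) ∈ N.map V.incl := LieSubmodule.mem_map_of_mem hx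
    rw [h, LieSubmodule.mem_bot] at h1
    simpa using h1
  obtain ⟨χ, w, hwN, hw⟩ := exists_isHighestWeightVector b _ hN'
  obtain ⟨w, hwN', rfl⟩ := (LieSubmodule.mem_map _).mp hwN
  obtain ⟨h1, h2⟩ := hv.weight_of_mem_lieSpan w.2 hw.ne_zero hw.lie_cartan
  have hcw : casimir L M w = c • (w : M) := sub_eq_zero.mp (hVK w.2)
  obtain ⟨d, hd⟩ := h2 (hv.eq_of_casimir_eq hw h1 hcv hcw)
  have hd' : (w : M) = d • v := hd
  have hd0 : d ≠ 0 := by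
    rintro rfl
    exact hw.ne_zero (hd.trans (zero_smul ℂ v))
  have hvN : (⟨v, hvV⟩ : V) ∈ N := by
    have h3 : (⟨v, hvV⟩ : V) = d⁻¹ • w := by
      ext
      simp [hd', hd0]
    rw [h3]
    exact N.smul_mem _ hwN'
  have h4 : V ≤ N.map V.incl := by
    refine LieSubmodule.lieSpan_le.mpr (Set.singleton_subset_iff.mpr ?_)
    exact LieSubmodule.mem_map_of_mem (f := V.incl) hvN
  rw [eq_top_iff]
  intro x _
  obtain ⟨y, hy, hyx⟩ := (LieSubmodule.mem_map _).mp (h4 x.2)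
  rwa [← Subtype.ext hyx]

lemma IsHighestWeightVector.exists_isIrreducible [FiniteDimensional ℂ M] {μ : Module.Dual ℂ H}
    {v : M} (hv : IsHighestWeightVector b μ v) :
    ∃ Y : LieSubmodule ℂ L M, LieModule.IsIrreducible ℂ L Y ∧ HasHighestWeight b Y μ :=
  ⟨LieSubmodule.lieSpan ℂ L {v}, hv.isIrreducible_lieSpan,
    ⟨v, LieSubmodule.subset_lieSpan rfl⟩, fun h ↦ hv.ne_zero (congrArg Subtype.val h),
    fun t ↦ Subtype.ext (hv.lie_cartan t), fun β hβ x hx ↦ Subtype.ext (hv.lie_pos β hβ x hx)⟩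

end HighestWeight

/-! ### The equivariant family of operators Q(x, y). -/

section QuadraticOperator

variable {L : Type*} [LieRing L] [LieAlgebra ℂ L]

/-- The operator `w ↦ ⁅x, ⁅y, w⁆⁆ + k (κ(y, w) x + κ(x, w) y)`, where `κ` is the Killing form. -/
noncomputable def quadraticOperator (k : ℂ) (x y : L) : L →ₗ[ℂ] L :=
  (ad ℂ L x : L →ₗ[ℂ] L) ∘ₗ (ad ℂ L y : L →ₗ[ℂ] L) +
    k • ((killingForm ℂ L y).smulRight x + (killingForm ℂ L x).smulRight y)

lemma quadraticOperator_apply (k : ℂ) (x y w : L) :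
    quadraticOperator k x y w =
      ⁅x, ⁅y, w⁆⁆ + k • (killingForm ℂ L y w • x + killingForm ℂ L x w • y) := by
  simp [quadraticOperator]

lemma killingForm_lie_left (x y z : L) :
    killingForm ℂ L ⁅x, y⁆ z = -killingForm ℂ L y ⁅x, z⁆ := by
  rw [← lie_skew, map_neg, LinearMap.neg_apply]
  congr 1
  exact LieModule.traceForm_apply_lie_apply ℂ L L y x z

lemma quadraticOperator_derivation (k : ℂ) (u x y : L) :
    (ad ℂ L u : L →ₗ[ℂ] L) ∘ₗ quadraticOperator k x y -
        quadraticOperator k x y ∘ₗ (ad ℂ L u : L →ₗ[ℂ] L) =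
      quadraticOperator k ⁅u, x⁆ y + quadraticOperator k x ⁅u, y⁆ := by
  ext w
  simp only [LinearMap.sub_apply, LinearMap.add_apply, LinearMap.comp_apply, ad_apply,
    quadraticOperator_apply, lie_add, lie_smul, killingForm_lie_left, neg_smul]
  rw [leibniz_lie u x, leibniz_lie u y, lie_add]
  module

/-- Each ad is skew for κ, so the adjoint of ad x ∘ ad y is ad y ∘ ad x, equal to it when x and y
commute. -/
lemma killingForm_quadraticOperator (k : ℂ) {x y : L} (hxy : ⁅x, y⁆ = 0) (v w : L) :
    killingForm ℂ L (quadraticOperator k x y v) w =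
      killingForm ℂ L v (quadraticOperator k x y w) := by
  have h : ⁅x, ⁅y, w⁆⁆ = ⁅y, ⁅x, w⁆⁆ := by rw [leibniz_lie, hxy, zero_lie, zero_add]
  simp only [quadraticOperator_apply, map_add, map_smul, LinearMap.add_apply, LinearMap.smul_apply,
    killingForm_lie_left, neg_neg, h, smul_eq_mul]
  rw [LieModule.traceForm_comm ℂ L L v x, LieModule.traceForm_comm ℂ L L v y]
  ring

/-- If `(ad e)²` has rank one and `z = ⁅u, e⁆` commutes with `e`, then `ad e ∘ ad z` is determined
by the Killing form. -/
lemma quadraticOperator_eq_zero {k : ℂ} {e : L}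
    (he : ∀ w, ⁅e, ⁅e, w⁆⁆ = -(2 * k * killingForm ℂ L e w) • e) {u z : L} (hz : z = ⁅u, e⁆)
    (hez : ⁅e, z⁆ = 0) : quadraticOperator k e z = 0 := by
  have h0 : quadraticOperator k e e = 0 := by
    ext w
    rw [quadraticOperator_apply, he]
    simp only [LinearMap.zero_apply]
    module
  -- Differentiating Q(e, e) = 0 along u gives Q(z, e) + Q(e, z) = 0, and the two terms agree since
  -- e and z commute.
  have h1 := quadraticOperator_derivation k u e e
  rw [← hz, h0] at h1
  have h2 : quadraticOperator k z e = quadraticOperator k e z := by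
    ext w
    have h3 : ⁅e, ⁅z, w⁆⁆ = ⁅z, ⁅e, w⁆⁆ := by rw [leibniz_lie, hez, zero_lie, zero_add]
    rw [quadraticOperator_apply, quadraticOperator_apply, h3]
    module
  rw [h2, LinearMap.comp_zero, LinearMap.zero_comp, sub_zero, ← two_smul ℂ] at h1
  exact (smul_eq_zero.mp h1.symm).resolve_left two_ne_zero

end QuadraticOperator

/-! ### Extremality of the highest root and the centralizer of its triple. -/

section HighestRoot

variable {L : Type*} [LieRing L] [LieAlgebra ℂ L] [FiniteDimensional ℂ L] [IsKilling ℂ L]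
  {H : LieSubalgebra ℂ L} [H.IsCartanSubalgebra] {b : (rootSystem H).Base} {α₀ : H.root}

lemma IsHighestRoot.eq_of_sub_mem (hα₀ : IsHighestRoot b α₀) {χ : Module.Dual ℂ H} {x : L}
    (hx : x ∈ rootSpace H χ) (hx0 : x ≠ 0) (hχ : χ - (rootSystem H).root α₀ ∈ posCone b) :
    χ = (rootSystem H).root α₀ := by
  by_cases hχ0 : χ = 0
  · exfalso
    obtain ⟨γ, hγ⟩ := exists_neg_root α₀
    have hγ' : (rootSystem H).root γ = -(rootSystem H).root α₀ :=
      LinearMap.ext fun t ↦ congrFun hγ t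
    have h1 := hα₀ γ
    rw [hγ', sub_neg_eq_add] at h1
    rw [hχ0, zero_sub] at hχ
    have h2 := eq_zero_of_mem_posCone_of_neg_mem h1 (by
      rw [neg_add]
      exact add_mem hχ hχ)
    rw [← two_smul ℂ, smul_eq_zero] at h2
    exact (rootSystem H).ne_zero α₀ (h2.resolve_left two_ne_zero)
  · have hbot : rootSpace H χ ≠ ⊥ := fun h ↦ hx0 (by rwa [h, LieSubmodule.mem_bot] at hx)
    let γ : Weight ℂ H L := ⟨χ, hbot⟩
    have hγ : γ.IsNonZero := fun h ↦ hχ0 (DFunLike.coe_injective h)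
    have h1 := hα₀ ⟨γ, by simpa using hγ⟩
    have h2 : (rootSystem H).root ⟨γ, by simpa using hγ⟩ = χ := LinearMap.ext fun _ ↦ rfl
    rw [h2] at h1
    exact sub_eq_zero.mp (eq_zero_of_mem_posCone_of_neg_mem hχ (by rwa [neg_sub]))

lemma lie_mem_rootSpace_add {χ ψ : Module.Dual ℂ H} {x y : L}
    (hx : x ∈ rootSpace H χ) (hy : y ∈ rootSpace H ψ) :
    ⁅x, y⁆ ∈ rootSpace H (χ + ψ : Module.Dual ℂ H) := by
  have h : ((χ + ψ : Module.Dual ℂ H) : H → ℂ) = χ + ψ := rfl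
  rw [h]
  exact lie_mem_genWeightSpace_of_mem_genWeightSpace hx hy

lemma mem_rootSpace_root {β : H.root} {x : L} (hx : x ∈ rootSpace H β.1) :
    x ∈ rootSpace H ((rootSystem H).root β) := by
  rwa [rootSystem_root_apply, Weight.coe_coe]

lemma IsHighestRoot.lie_eq_zero (hα₀ : IsHighestRoot b α₀) {e : L} (he : e ∈ rootSpace H α₀.1)
    {β : H.root} (hβ : (rootSystem H).root β ∈ posCone b) {y : L} (hy : y ∈ rootSpace H β.1) :
    ⁅y, e⁆ = 0 := by
  by_contra h
  have h1 := lie_mem_rootSpace_add (mem_rootSpace_root hy) (mem_rootSpace_root he)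
  have h2 := hα₀.eq_of_sub_mem h1 h (by rwa [add_sub_cancel_right])
  exact (rootSystem H).ne_zero β (add_eq_right.mp h2)

/-- The vectors of the highest root space are extremal. -/
lemma IsHighestRoot.lie_lie_eq (hα₀ : IsHighestRoot b α₀) {t₀ e f : L} (ht : IsSl2Triple t₀ e f)
    (he : e ∈ rootSpace H α₀.1) (hf : f ∈ rootSpace H (-α₀.1 : H → ℂ))
    (hef : killingForm ℂ L e f ≠ 0) (w : L) :
    ⁅e, ⁅e, w⁆⁆ = -(2 * (killingForm ℂ L e f)⁻¹ * killingForm ℂ L e w) • e := by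
  induction w using rootSpace_induction H with
  | h0 w hw =>
    have h1 : killingForm ℂ L e w = 0 :=
      killingForm_apply_eq_zero_of_mem_rootSpace_of_add_ne_zero ℂ L H he
        (toLieSubmodule_le_rootSpace_zero ℂ L H hw)
        (by simp [LieSubalgebra.isNonZero_coe_root α₀])
    have h2 : ⁅w, e⁆ = α₀.1 ⟨w, hw⟩ • e := lie_eq_smul_of_mem_rootSpace he ⟨w, hw⟩
    rw [← lie_skew e w, h2, h1]
    simp
  | h1 β w hw =>
    by_cases hβ : (β.1 : H → ℂ) = -α₀.1
    · obtain ⟨c, rfl⟩ := exists_smul_of_mem_rootSpace β (by rwa [hβ]) ht.f_ne_zero hw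
      have h1 : ⁅e, t₀⁆ = -((2 : ℂ) • e) := by
        rw [← lie_skew, ht.lie_h_e_smul ℂ]
      rw [lie_smul, lie_smul, ht.lie_e_f, h1, map_smul, smul_eq_mul, smul_neg, smul_smul,
        ← neg_smul]
      congr 1
      field_simp
    · have h1 : killingForm ℂ L e w = 0 :=
        killingForm_apply_eq_zero_of_mem_rootSpace_of_add_ne_zero ℂ L H he hw fun h ↦
          hβ (eq_neg_of_add_eq_zero_right h)
      rw [h1, mul_zero, neg_zero, zero_smul]
      by_contra hne
      -- The weight 2α₀ + β exceeds α₀ by α₀ - (-β), which lies in the cone because -β is a root.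
      have h2 := lie_mem_rootSpace_add (mem_rootSpace_root he)
        (lie_mem_rootSpace_add (mem_rootSpace_root he) (mem_rootSpace_root hw))
      obtain ⟨γ, hγ⟩ := exists_neg_root β
      have hγ' : (rootSystem H).root γ = -(rootSystem H).root β :=
        LinearMap.ext fun t ↦ congrFun hγ t
      have h3 := hα₀.eq_of_sub_mem h2 hne (by
        have := hα₀ γ
        rw [hγ', sub_neg_eq_add] at this
        rwa [add_sub_cancel_left])
      rw [add_eq_left] at h3
      exact hβ (congrArg DFunLike.coe (eq_neg_of_add_eq_zero_right h3))
  | hadd x y hx hy =>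
    rw [lie_add, lie_add, hx, hy, map_add]
    module

lemma exists_ne_zero_apply_eq_zero_of_not_isTypeA1 (hA1 : ¬ IsTypeA1 b) (α : H.root) :
    ∃ x : H, x ≠ 0 ∧ α.1 x = 0 := by
  by_contra! h
  have hinj : Function.Injective α.1.toLinear := by
    rw [← LinearMap.ker_eq_bot, LinearMap.ker_eq_bot']
    intro x hx
    by_contra hx0
    exact h x hx0 hx
  have h1 := LinearMap.finrank_le_finrank_of_injective hinj
  rw [Module.finrank_eq_card_basis b.toCoweightBasis, Module.finrank_self, Fintype.card_coe] at h1
  have : Nonempty H.root := ⟨α⟩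
  have h2 : b.support.card = 1 := le_antisymm h1 b.support_nonempty.card_pos
  have e : b.support ≃ Fin 1 := Fintype.equivFinOfCardEq (by simpa using h2)
  have : Subsingleton b.support := e.subsingleton
  refine hA1 ⟨e, ?_⟩
  ext i j
  rw [Subsingleton.elim i j, RootPairing.Base.cartanMatrix_apply_same, Matrix.submatrix_apply]
  generalize e j = k
  fin_cases k
  rfl

/-- A highest root vector of the centralizer of the `sl₂`-triple of the highest root; if this
centralizer has no roots, a nonzero element of it. -/
lemma exists_highestRootVector_centralizer (hA1 : ¬ IsTypeA1 b) {t₀ e f : L}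
    (ht : IsSl2Triple t₀ e f) (he : e ∈ rootSpace H α₀.1) (hf : f ∈ rootSpace H (-α₀.1 : H → ℂ))
    {α' : Module.Dual ℂ H} (hα' : IsHighestRootOf b (lieCentralizer ℂ L {t₀, e, f}) α') :
    ∃ x ∈ lieCentralizer ℂ L {t₀, e, f}, x ≠ 0 ∧ (∀ t : H, ⁅(t : L), x⁆ = α' t • x) ∧
      ∀ β : H.root, (rootSystem H).root β ∈ posCone b → ∀ y ∈ rootSpace H β.1,
        y ∈ lieCentralizer ℂ L {t₀, e, f} → ⁅y, x⁆ = 0 := by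
  set h := lieCentralizer ℂ L {t₀, e, f}
  have hroot {β : H.root} {y : L} (hy : y ∈ rootSpace H β.1) (hyh : y ∈ h) (hy0 : y ≠ 0) :
      IsRootOf h ((rootSystem H).root β) :=
    ⟨(rootSystem H).ne_zero β, y, hyh, hy0, fun t ↦ lie_eq_smul_of_mem_rootSpace hy t⟩
  rcases hα' with ⟨⟨hα'0, x, hxh, hx0, hx⟩, hmax⟩ | ⟨hno, rfl⟩
  · refine ⟨x, hxh, hx0, hx, fun β hβ y hy hyh ↦ ?_⟩
    by_contra hne
    have hβh := hroot hy hyh fun h ↦ hne (by rw [h, zero_lie])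
    have hmem : (rootSystem H).root β ∈
        AddSubmonoid.closure {γ | IsRootOf h γ ∧ γ ∈ posCone b} :=
      AddSubmonoid.subset_closure ⟨hβh, hβ⟩
    -- If α' = -β, then β is itself a root of the centralizer above α'; otherwise α' + β is.
    by_cases hsum : α' + (rootSystem H).root β = 0
    · have h1 : α' = -(rootSystem H).root β := eq_neg_of_add_eq_zero_left hsum
      have h2 := hmax _ hβh (by
        rw [h1, sub_neg_eq_add]
        exact add_mem hmem hmem)
      rw [h2, ← two_smul ℂ, smul_eq_zero] at hsum
      exact hα'0 (hsum.resolve_left two_ne_zero)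
    · have h1 := hmax _ ⟨hsum, ⁅y, x⁆, h.lie_mem hyh hxh, hne, lie_mem_weightSpace_add hy hx⟩
        (by rwa [add_sub_cancel_left])
      exact (rootSystem H).ne_zero β (add_eq_left.mp h1)
  -- Outside rank one, α₀ has a nonzero kernel in H, and this kernel centralizes the triple.
  · obtain ⟨x, hx0, hx⟩ := exists_ne_zero_apply_eq_zero_of_not_isTypeA1 hA1 α₀
    have hxe : ⁅(x : L), e⁆ = 0 := by
      have h1 : ⁅(x : L), e⁆ = α₀.1 x • e := lie_eq_smul_of_mem_rootSpace he x
      rw [h1, hx, zero_smul]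
    have hxf : ⁅(x : L), f⁆ = 0 := by
      have h1 : ⁅(x : L), f⁆ = (-α₀.1 : H → ℂ) x • f := lie_eq_smul_of_mem_rootSpace hf x
      rw [h1, Pi.neg_apply, hx, neg_zero, zero_smul]
    have hxt : ⁅(x : L), t₀⁆ = 0 := by
      rw [← ht.lie_e_f, leibniz_lie, hxe, hxf, zero_lie, lie_zero, add_zero]
    refine ⟨x, ?_, by simpa using hx0, fun t ↦ ?_, fun β _ y hy hyh ↦ ?_⟩
    · rintro y (rfl | rfl | rfl)
      exacts [hxt, hxe, hxf]
    · have h1 : ⁅t, x⁆ = 0 := trivial_lie_zero H H t x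
      rw [LinearMap.zero_apply, zero_smul]
      exact congrArg Subtype.val h1
    · have : y = 0 := by
        by_contra hy0
        exact hno _ (hroot hy hyh hy0)
      rw [this, zero_lie]

end HighestRoot

end Decomposition

/-! ### The highest weight vector of weight α₀ + α'. -/

theorem proposition3p1
    {L : Type*} [LieRing L] [LieAlgebra ℂ L] [FiniteDimensional ℂ L] [LieAlgebra.IsSimple ℂ L]
    (H : LieSubalgebra ℂ L) [H.IsCartanSubalgebra]
    (b : (LieAlgebra.IsKilling.rootSystem H).Base) (hA1 : ¬ IsTypeA1 b)
    (α₀ : H.root) (hα₀ : IsHighestRoot b α₀)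
    (t₀ e f : L) (ht : IsSl2Triple t₀ e f)
    (he : e ∈ LieAlgebra.rootSpace H α₀.1) (hf : f ∈ LieAlgebra.rootSpace H (-α₀.1))
    (α' : Module.Dual ℂ H) (hα' : IsHighestRootOf b (lieCentralizer ℂ L {t₀, e, f}) α') :
    ∃ Y : LieSubmodule ℂ L (symSquare ℂ L),
      LieModule.IsIrreducible ℂ L Y ∧
      HasHighestWeight b Y ((LieAlgebra.IsKilling.rootSystem H).root α₀ + α') := by
  obtain ⟨x, hxh, hx0, hx, hxpos⟩ := exists_highestRootVector_centralizer hA1 ht he hf hα'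
  have hxt : ⁅x, t₀⁆ = 0 := hxh t₀ (by simp)
  have hxe : ⁅x, e⁆ = 0 := hxh e (by simp)
  have hxf : ⁅x, f⁆ = 0 := hxh f (by simp)
  have hex : ⁅e, x⁆ = 0 := by rw [← lie_skew, hxe, neg_zero]
  have hα₀0 := LieSubalgebra.isNonZero_coe_root α₀
  have hef : killingForm ℂ L e f ≠ 0 := fun h ↦ ht.h_ne_zero <| by
    rw [← ht.lie_e_f, LieAlgebra.IsKilling.lie_eq_killingForm_smul_of_mem_rootSpace_of_mem_rootSpace_neg he hf, h,
      zero_smul]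
  -- This normalization is forced by [e, [e, f]] = -2e, that is, by Q(e, e) f = 0.
  set k := (killingForm ℂ L e f)⁻¹ with hk
  set T := quadraticOperator k e x with hT
  have hTf : T f = x := by
    have h1 : killingForm ℂ L x f = 0 := by
      have h2 : killingForm ℂ L ⁅t₀, x⁆ f = 0 := by
        rw [← lie_skew, hxt, neg_zero, map_zero, LinearMap.zero_apply]
      rw [killingForm_lie_left, ht.lie_lie_smul_f ℂ] at h2
      simpa using h2
    rw [hT, quadraticOperator_apply, hxf, h1, hk]
    simp [smul_smul, hef]
  have hTsymm := killingTensorEquiv_symm_mem_symSquare (killingForm_quadraticOperator k hex)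
  have hlie (y : L) : ⁅y, (killingTensorEquiv L).symm T⁆ =
      (killingTensorEquiv L).symm (quadraticOperator k ⁅y, e⁆ x + quadraticOperator k e ⁅y, x⁆) := by
    rw [LinearEquiv.eq_symm_apply, killingTensorEquiv_lie, LinearEquiv.apply_symm_apply,
      hT, quadraticOperator_derivation]
  let v : symSquare ℂ L := ⟨(killingTensorEquiv L).symm T, hTsymm⟩
  suffices hv : IsHighestWeightVector b ((LieAlgebra.IsKilling.rootSystem H).root α₀ + α') v from
    hv.exists_isIrreducible
  refine ⟨fun h ↦ hx0 ?_, fun t ↦ Subtype.ext ?_, fun β hβ y hy ↦ Subtype.ext ?_⟩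
  · have h1 : (killingTensorEquiv L).symm T = 0 := congrArg Subtype.val h
    rw [LinearEquiv.map_eq_zero_iff] at h1
    rw [← hTf, h1, LinearMap.zero_apply]
  · change ⁅(t : L), (killingTensorEquiv L).symm T⁆ = _ • (killingTensorEquiv L).symm T
    have h1 : ⁅(t : L), e⁆ = (LieAlgebra.IsKilling.rootSystem H).root α₀ t • e := LieAlgebra.IsKilling.lie_eq_smul_of_mem_rootSpace he t
    rw [hlie, ← map_smul, h1, hx]
    congr 1
    ext w
    simp only [hT, quadraticOperator_apply, LinearMap.add_apply, LinearMap.smul_apply, smul_lie,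
      lie_smul, map_smul, smul_eq_mul]
    module
  · change ⁅y, (killingTensorEquiv L).symm T⁆ = 0
    have hye : ⁅y, e⁆ = 0 := hα₀.lie_eq_zero he hβ hy
    have hey : ⁅e, y⁆ = 0 := by rw [← lie_skew, hye, neg_zero]
    have h0 : quadraticOperator k (0 : L) x = 0 := by
      ext w
      simp [quadraticOperator_apply]
    rw [hlie, hye, h0, zero_add, LinearEquiv.map_eq_zero_iff]
    have hty : ⁅t₀, y⁆ = β.1 (LieAlgebra.IsKilling.coroot α₀.1) • y := by
      rw [ht.h_eq_coroot hα₀0 he hf]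
      exact LieAlgebra.IsKilling.lie_eq_smul_of_mem_rootSpace hy (LieAlgebra.IsKilling.coroot α₀.1)
    -- At t₀-weight 0, y is primitive of weight 0 for the triple, so f kills it too and y lies in
    -- the centralizer.
    by_cases hc : β.1 (LieAlgebra.IsKilling.coroot α₀.1) = 0
    · suffices hyx : ⁅y, x⁆ = 0 by
        ext w
        simp [quadraticOperator_apply, hyx]
      rcases eq_or_ne y 0 with rfl | hy0
      · exact zero_lie x
      have P : ht.HasPrimitiveVectorWith y (0 : ℂ) := ⟨hy0, by rw [hty, hc], hey⟩
      have hfy : ⁅f, y⁆ = 0 := by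
        simpa using P.pow_toEnd_f_eq_zero_of_eq_nat (n := 0) (by simp)
      refine hxpos β hβ y hy ?_
      rintro z (rfl | rfl | rfl)
      · rw [← lie_skew, hty, hc, zero_smul, neg_zero]
      · exact hye
      · rw [← lie_skew, hfy, neg_zero]
    · have htz : ⁅t₀, ⁅y, x⁆⁆ = β.1 (LieAlgebra.IsKilling.coroot α₀.1) • ⁅y, x⁆ := by
        rw [leibniz_lie, hty, ← lie_skew t₀ x, hxt, neg_zero, lie_zero, add_zero, smul_lie]
      have hez : ⁅e, ⁅y, x⁆⁆ = 0 := by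
        rw [leibniz_lie, hey, hex, zero_lie, lie_zero, add_zero]
      -- Since e kills z = [y, x], one has [[z, f], e] = [t₀, z], a nonzero multiple of z; dividing
      -- by that scalar gives u.
      refine quadraticOperator_eq_zero (hα₀.lie_lie_eq ht he hf hef)
        (u := (β.1 (LieAlgebra.IsKilling.coroot α₀.1))⁻¹ • ⁅⁅y, x⁆, f⁆) ?_ hez
      have h1 : ⁅⁅⁅y, x⁆, f⁆, e⁆ = ⁅t₀, ⁅y, x⁆⁆ := by
        rw [lie_lie, ← lie_skew f e, ht.lie_e_f, ← lie_skew _ e, hez, lie_neg, lie_skew, neg_zero,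
          lie_zero, sub_zero]
      rw [smul_lie, h1, htz, smul_smul, inv_mul_cancel₀ hc, one_smul]
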